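/- Let $\alpha,\beta\in[0,1]$ and consider the probabilistic cellular automaton $F$ on $\Omega=\{\ominus,\oplus\}^{\mathbb Z}$ in which, at each time step, all sites are updated simultaneously and independently given the present configuration $x$: site $k$ becomes $\oplus$ with probability $\theta(\oplus\mid x_k x_{k+1})$ and $\ominus$ otherwise, where $$\theta(\oplus\mid\ominus\ominus)=0,\quad \theta(\oplus\mid\oplus\ominus)=\beta,\quad \theta(\oplus\mid\ominus\oplus)=\alpha,\quad \theta(\oplus\mid\oplus\oplus)=1 .$$ An island of pluses (respectively of minuses) is a configuration that differs from "all minuses" (respectively from "all pluses") at finitely many sites only; its length is the number of sites of the smallest segment of $\mathbb Z$ containing all its pluses (respectively minuses), and is $0$ if there are none. An archipelago of pluses (respectively of minuses) is a probability measure $\mu$ on $\Omega$ concentrated on the countable set of islands of pluses (respectively of minuses), and $\mathrm{giant}(\mu)\in\mathbb N\cup\{\infty\}$ is the greatest length of the islands to which $\mu$ gives positive mass ($\infty$ if these lengths are unbounded). For such $\mu$, let $\tau_\mu\in\mathbb N\cup\{\infty\}$ be the first time $t\ge 0$ at which the Markov chain with initial distribution $\mu$ and transition mechanism $F$ is in the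 configuration "all minuses" or in the configuration "all pluses" ($\infty$ if there is no such time). Suppose that $\alpha>0$ and $\beta<1$. (A) If $\alpha<1-\beta$, then $F$ is an eroder of archipelagos of pluses in mean linear time: there is a constant $k$, depending only on $\alpha$ and $\beta$, such that $\mathbb E(\tau_\mu)\le k\,(1+\mathrm{giant}(\mu))$ for every archipelago of pluses $\mu$ with $\mathrm{giant}(\mu)<\infty$. (B) If $\alpha>1-\beta$, then $F$ is an eroder of archipelagos of minuses in mean linear time: there is a constant $k$, depending only on $\alpha$ and $\beta$, such that $\mathbb E(\tau_\mu)\le k\,(1+\mathrm{giant}(\mu))$ for every archipelago of minuses $\mu$ with $\mathrm{giant}(\mu)<\infty$. -/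

import Mathlib

open MeasureTheory ProbabilityTheory
open scoped ENNReal NNReal unitInterval

noncomputable section

namespace IslandPCA

/-- The two states of a site: `true` is plus and `false` is minus. -/
abbrev Spin : Type := Bool

/-- Configurations on `ℤ`, with the product σ-algebra (generated by the cylinders). -/
abbrev Config : Type := ℤ → Spin

/-- The configuration all of whose components are minuses. -/
def allMinus : Config := fun _ => false

/-- The configuration all of whose components are pluses. -/
def allPlus : Config := fun _ => true

/-- Two configurations are close if they differ at finitely many sites only. -/
def Close (x y : Config) : Prop := {i : ℤ | x i ≠ y i}.Finite

/-- The set of islands of pluses. -/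
def islandsPlus : Set Config := {x | Close x allMinus}

/-- The set of islands of minuses. -/
def islandsMinus : Set Config := {x | Close x allPlus}

/-- The space of islands. -/
def islands : Set Config := islandsMinus ∪ islandsPlus

open Classical in
/-- The length `max - min + 1` of the smallest segment of `ℤ` containing a finite set `S` of
sites; it is `0` for the empty set. -/
def span (S : Set ℤ) : ℕ := if S.Nonempty then (sSup S - sInf S + 1).toNat else 0

open Classical in
/-- The length of an island: the length of the smallest segment that contains all the pluses
of an island of pluses, respectively all the minuses of an island of minuses. -/
def length (x : Config) : ℕ :=
  if x ∈ islandsPlus then span {i | x i = true} else span {i | x i = false}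

/-- An archipelago of pluses: a normalized measure concentrated on the islands of pluses. -/
def IsArchipelagoPlus (μ : Measure Config) : Prop :=
  IsProbabilityMeasure μ ∧ ∀ᵐ x ∂μ, x ∈ islandsPlus

/-- An archipelago of minuses: a normalized measure concentrated on the islands of minuses. -/
def IsArchipelagoMinus (μ : Measure Config) : Prop :=
  IsProbabilityMeasure μ ∧ ∀ᵐ x ∂μ, x ∈ islandsMinus

/-- The greatest length of the islands charged by `μ`, and `⊤` if these lengths are unbounded. -/
def giant (μ : Measure Config) : ℕ∞ :=
  ⨆ x ∈ {x : Config | x ∈ islands ∧ μ {x} ≠ 0}, (length x : ℕ∞)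

/-- The probability `θ(+ | a₀ a₁)` that a site becomes plus if its state is `a₀` and the state
of its right neighbour is `a₁`. -/
def thetaPlus (α β : I) : Spin → Spin → I
  | false, false => 0
  | true, false => β
  | false, true => α
  | true, true => 1

/-- The law of the new configuration given the old configuration `x`: the sites are updated
independently, site `k` becoming plus with probability `θ(+ | x_k x_{k+1})` and minus with the
complementary probability. -/
def stepMeasure (α β : I) (x : Config) : Measure Config :=
  Measure.infinitePi fun k : ℤ => bernoulliMeasure true false (thetaPlus α β (x k) (x (k + 1)))

instance (α β : I) (x : Config) : IsProbabilityMeasure (stepMeasure α β x) := by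
  unfold stepMeasure; infer_instance

theorem measurable_pair (g : Spin → Spin → ℝ≥0∞) (i j : ℤ) :
    Measurable fun x : Config => g (x i) (x j) := by
  have hg : Measurable (Function.uncurry g) := measurable_of_countable _
  have hi : Measurable fun x : Config => x i := measurable_pi_apply i
  have hj : Measurable fun x : Config => x j := measurable_pi_apply j
  exact hg.comp (hi.prodMk hj)

theorem measurable_site (α β : I) (k : ℤ) (u : Set Spin) :
    Measurable fun x : Config =>
      bernoulliMeasure true false (thetaPlus α β (x k) (x (k + 1))) u :=
  measurable_pair (fun a b => bernoulliMeasure true false (thetaPlus α β a b) u) k (k + 1)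

theorem stepMeasure_pi (α β : I) (x : Config) (s : Finset ℤ) (t : ℤ → Set Spin) :
    stepMeasure α β x ((s : Set ℤ).pi t) =
      ∏ k ∈ s, bernoulliMeasure true false (thetaPlus α β (x k) (x (k + 1))) (t k) := by
  unfold stepMeasure
  exact Measure.infinitePi_pi _ fun i _ => (t i).toFinite.measurableSet

theorem measurable_stepMeasure (α β : I) : Measurable (stepMeasure α β) := by
  have hpi : IsPiSystem (squareCylinders fun _ : ℤ => {s : Set Spin | MeasurableSet s}) := by
    apply isPiSystem_squareCylinders
    · intro _
      exact MeasurableSpace.isPiSystem_measurableSet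
    · intro _
      exact MeasurableSet.univ (α := Spin)
  have hgen := (generateFrom_squareCylinders (α := fun _ : ℤ => Spin)).symm
  apply Measurable.measure_of_isPiSystem_of_isProbabilityMeasure hgen hpi
  rintro _ ⟨s, t, -, rfl⟩
  simp only [stepMeasure_pi]
  exact Finset.measurable_prod s fun k _ => measurable_site α β k (t k)

/-- The transition kernel of the probabilistic cellular automaton; the operator `F` sends a
measure `μ` to `μ.bind (F α β)`. -/
def F (α β : I) : Kernel Config Config where
  toFun := stepMeasure α β
  measurable' := measurable_stepMeasure α β

instance (α β : I) : IsMarkovKernel (F α β) :=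
  ⟨fun x => inferInstanceAs (IsProbabilityMeasure (stepMeasure α β x))⟩

/-- The transition kernel at time `n`, which depends on the past only through the present. -/
def stepKernel (α β : I) (n : ℕ) : Kernel (Finset.Iic n → Config) Config :=
  (F α β).comap (fun h => h ⟨n, Finset.mem_Iic.2 le_rfl⟩) (measurable_pi_apply _)

instance (α β : I) (n : ℕ) : IsMarkovKernel (stepKernel α β n) := by
  unfold stepKernel; infer_instance

/-- The law, on the space of trajectories, of the Markov chain of configurations with initial
distribution `μ` and transition kernel `F α β`. -/
def pathMeasure (α β : I) (μ : Measure Config) : Measure (ℕ → Config) :=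
  Kernel.trajMeasure (X := fun _ => Config) μ (stepKernel α β)

/-- The first time at which a trajectory is at "all minuses" or at "all pluses"
(`⊤` if there is none). -/
def tau (ω : ℕ → Config) : ℕ∞ :=
  ⨅ t ∈ {t : ℕ | ω t = allMinus ∨ ω t = allPlus}, (t : ℕ∞)

/-- The mean of `tau` for the process with initial distribution `μ`. -/
def meanTau (α β : I) (μ : Measure Config) : ℝ≥0∞ :=
  ∫⁻ ω, (tau ω : ℝ≥0∞) ∂(pathMeasure α β μ)

/-- `F` is an eroder of archipelagos of pluses in mean linear time. -/
def ErodesPlusInMeanLinearTime (α β : I) : Prop :=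
  ∃ k : ℝ≥0, ∀ μ : Measure Config, IsArchipelagoPlus μ → giant μ ≠ ⊤ →
    meanTau α β μ ≤ k * (1 + (giant μ : ℝ≥0∞))

/-- `F` is an eroder of archipelagos of minuses in mean linear time. -/
def ErodesMinusInMeanLinearTime (α β : I) : Prop :=
  ∃ k : ℝ≥0, ∀ μ : Measure Config, IsArchipelagoMinus μ → giant μ ≠ ⊤ →
    meanTau α β μ ≤ k * (1 + (giant μ : ℝ≥0∞))

end IslandPCA

end

namespace IslandPCA

/-! The number of sites in the eroding state is a Lyapunov function. For finitely many pluses, a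
mean update loses `1 - β` at each boundary `+-` and gains `α` at each boundary `-+`. These
boundaries are equally many, with at least one of each unless there is no plus, so the mean drift is
at most `-(1 - α - β)`; for minuses it is at most `-(α + β - 1)`. `lintegral_count_add_le` proves
this by summing a local inequality over `ℤ`. `mul_meanTau_le` sums the drift over time, and the
initial count is at most the length of the island. -/

/-- The number of sites in state `s`. -/
noncomputable def count (s : Spin) (x : Config) : ℝ≥0∞ := ∑' k : ℤ, if x k = s then 1 else 0

theorem measurableSet_site_eq (s : Spin) (k : ℤ) : MeasurableSet {x : Config | x k = s} :=
  (measurable_pi_apply (X := fun _ : ℤ => Spin) k) (MeasurableSet.singleton s)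

theorem measurable_count (s : Spin) : Measurable (count s) :=
  Measurable.tsum fun k =>
    Measurable.ite (measurableSet_site_eq s k) measurable_const measurable_const

theorem count_eq_encard (s : Spin) (x : Config) :
    count s x = ({k | x k = s}.encard : ℝ≥0∞) := by
  rw [← ENNReal.tsum_set_one, tsum_subtype {k | x k = s} (fun _ => (1 : ℝ≥0∞))]
  simp [count, Set.indicator_apply]

theorem count_eq_zero_iff (s : Spin) (x : Config) : count s x = 0 ↔ ∀ k, x k ≠ s := by
  simp [count, ENNReal.tsum_eq_zero]

/-! ### One-step drift of the count -/

theorem lintegral_count_stepMeasure (α β : I) (s : Spin) (x : Config) :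
    ∫⁻ y, count s y ∂(stepMeasure α β x) =
      ∑' k : ℤ, bernoulliMeasure true false (thetaPlus α β (x k) (x (k + 1))) {s} := by
  unfold count
  rw [lintegral_tsum fun k => (Measurable.ite (measurableSet_site_eq s k) measurable_const
    measurable_const).aemeasurable]
  refine tsum_congr fun k => ?_
  have h : (fun y : Config => if y k = s then (1 : ℝ≥0∞) else 0) =
      {y : Config | y k = s}.indicator 1 := by
    ext y; simp [Set.indicator_apply]
  rw [h, lintegral_indicator_one (measurableSet_site_eq s k)]
  unfold stepMeasure
  exact (measurePreserving_eval_infinitePi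
    (fun j => bernoulliMeasure true false (thetaPlus α β (x j) (x (j + 1)))) k).measure_preimage
    (MeasurableSet.singleton s).nullMeasurableSet

/-- In a configuration with finitely many sites in state `s`, and at least one, some site in
state `s` has a right neighbour in the other state. -/
theorem exists_right_boundary {s : Spin} {x : Config} (hfin : count s x ≠ ⊤)
    (h0 : count s x ≠ 0) : ∃ k, x k = s ∧ x (k + 1) ≠ s := by
  have hf : {k | x k = s}.Finite := by
    rw [count_eq_encard] at hfin
    exact Set.encard_ne_top_iff.1 (by simpa using hfin)
  have hne : {k | x k = s}.Nonempty := by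
    by_contra h
    rw [Set.not_nonempty_iff_eq_empty] at h
    simp [count_eq_encard, h] at h0
  obtain ⟨k, hk, hmax⟩ := hf.exists_maximal hne
  refine ⟨k, hk, fun h => ?_⟩
  have := hmax (y := k + 1) h (by simp)
  simp at this

/-- If one update at a pair of neighbouring sites balances up to a gain `d` at each right
boundary, the mean number of sites in state `s` decreases by at least `d` at each step. -/
theorem lintegral_count_add_le (α β : I) (s : Spin) (c d : ℝ≥0∞) (hc : c ≠ ⊤)
    (hlocal : ∀ a b : Spin, bernoulliMeasure true false (thetaPlus α β a b) {s} +
      c * (if a = s then 1 else 0) + d * (if a = s ∧ b ≠ s then 1 else 0) ≤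
      (if a = s then 1 else 0) + c * (if b = s then 1 else 0)) (x : Config) :
    ∫⁻ y, count s y ∂(F α β x) + d * (if count s x = 0 then 0 else 1) ≤ count s x := by
  change ∫⁻ y, count s y ∂(stepMeasure α β x) + _ ≤ _
  rw [lintegral_count_stepMeasure]
  rcases eq_or_ne (count s x) ⊤ with htop | htop
  · simp [htop]
  -- Shift invariance makes the two `c` terms of `hlocal` have equal sums; this replaces matching
  -- left with right boundaries.
  have hshift : ∑' k : ℤ, (if x (k + 1) = s then (1 : ℝ≥0∞) else 0) = count s x :=
    (Equiv.addRight (1 : ℤ)).tsum_eq fun k => if x k = s then (1 : ℝ≥0∞) else 0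
  have hsum := ENNReal.tsum_le_tsum fun k : ℤ => hlocal (x k) (x (k + 1))
  rw [ENNReal.tsum_add, ENNReal.tsum_add, ENNReal.tsum_add, ENNReal.tsum_mul_left,
    ENNReal.tsum_mul_left, ENNReal.tsum_mul_left, hshift] at hsum
  change _ + c * count s x + _ ≤ count s x + c * count s x at hsum
  rw [add_right_comm] at hsum
  -- Cancelling in `ℝ≥0∞` requires `c * count s x` to be finite.
  have hcancel := (ENNReal.add_le_add_iff_right (ENNReal.mul_ne_top hc htop)).1 hsum
  refine le_trans ?_ hcancel
  gcongr
  split_ifs with h0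
  · exact zero_le
  obtain ⟨k, hk⟩ := exists_right_boundary htop h0
  refine le_trans (le_of_eq ?_) (ENNReal.le_tsum k)
  rw [if_pos hk]

/-! ### From the drift to the mean absorption time -/

theorem lintegral_pathMeasure_succ (α β : I) (μ : Measure Config) [IsProbabilityMeasure μ]
    {f : Config → ℝ≥0∞} (hf : Measurable f) (n : ℕ) :
    ∫⁻ ω, f (ω (n + 1)) ∂(pathMeasure α β μ) =
      ∫⁻ ω, ∫⁻ y, f y ∂(F α β (ω n)) ∂(pathMeasure α β μ) := by
  have h := Kernel.map_frestrictLe_trajMeasure_compProd_eq_map_trajMeasure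
    (X := fun _ => Config) (μ₀ := μ) (κ := stepKernel α β) (a := n)
  have hsnd : Measurable fun p : (Finset.Iic n → Config) × Config => f p.2 :=
    hf.comp measurable_snd
  have hint := congrArg (fun ν => ∫⁻ p, f p.2 ∂ν) h
  beta_reduce at hint
  rw [Measure.lintegral_compProd hsnd, lintegral_map hsnd (by fun_prop),
    lintegral_map hsnd.lintegral_kernel_prod_right' (by fun_prop)] at hint
  exact hint.symm

theorem map_eval_zero_pathMeasure (α β : I) (μ : Measure Config) [IsProbabilityMeasure μ] :
    (pathMeasure α β μ).map (fun ω => ω 0) = μ := by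
  have hm : Measurable fun h : (Finset.Iic 0 → Config) => h ⟨0, Finset.mem_Iic.2 le_rfl⟩ :=
    measurable_pi_apply _
  have h : (fun ω : ℕ → Config => ω 0) =
      (fun h : (Finset.Iic 0 → Config) => h ⟨0, Finset.mem_Iic.2 le_rfl⟩) ∘
        Preorder.frestrictLe (π := fun _ => Config) 0 := rfl
  rw [h, ← Measure.map_map hm (by fun_prop)]
  unfold pathMeasure Kernel.trajMeasure
  rw [Measure.map_comp _ _ (by fun_prop), Kernel.traj_map_frestrictLe, Kernel.partialTraj_self,
    Measure.id_comp, Measure.map_map hm (by fun_prop)]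
  exact Measure.map_id

/-- A zero count forces a constant configuration, and every time before the first zero contributes
1. Counting all nonzero times avoids any stopping-time argument. -/
theorem tau_le_tsum {s : Spin} (ω : ℕ → Config) :
    (tau ω : ℝ≥0∞) ≤ ∑' n, if count s (ω n) = 0 then (0 : ℝ≥0∞) else 1 := by
  have hall : ∀ x : Config, count s x = 0 → x = allMinus ∨ x = allPlus := by
    intro x hx
    rw [count_eq_zero_iff] at hx
    cases s
    · right; funext k; simpa [allPlus] using hx k
    · left; funext k; simpa [allMinus] using hx k
  by_cases hex : ∃ n, count s (ω n) = 0
  · classical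
    have h1 : tau ω ≤ (Nat.find hex : ℕ∞) := 
      iInf₂_le (f := fun (t : ℕ) (_ : t ∈ {t | ω t = allMinus ∨ ω t = allPlus}) => (t : ℕ∞))
        (Nat.find hex) (hall _ (Nat.find_spec hex))
    calc (tau ω : ℝ≥0∞) ≤ ((Nat.find hex : ℕ∞) : ℝ≥0∞) := by exact_mod_cast h1
      _ = ∑ n ∈ Finset.range (Nat.find hex), if count s (ω n) = 0 then (0 : ℝ≥0∞) else 1 := by
        rw [Finset.sum_congr rfl fun n hn => if_neg (Nat.find_min hex (Finset.mem_range.1 hn))]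
        simp
      _ ≤ _ := ENNReal.sum_le_tsum _
  · push Not at hex
    simp [hex]

/-- A Lyapunov bound: if the mean number of sites in state `s` decreases by `d` at each step,
the mean of `tau` is at most the initial mean number divided by `d`. -/
theorem mul_meanTau_le (α β : I) (s : Spin) (d : ℝ≥0∞)
    (hdrift : ∀ x, ∫⁻ y, count s y ∂(F α β x) + d * (if count s x = 0 then 0 else 1) ≤ count s x)
    (μ : Measure Config) [IsProbabilityMeasure μ] :
    d * meanTau α β μ ≤ ∫⁻ x, count s x ∂μ := by
  set P := pathMeasure α β μ with hP
  let e : ℕ → (ℕ → Config) → ℝ≥0∞ := fun n ω => if count s (ω n) = 0 then 0 else 1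
  have he : ∀ n, Measurable (e n) := fun n =>
    Measurable.ite ((measurable_count s).comp (measurable_pi_apply n) (MeasurableSet.singleton 0))
      measurable_const measurable_const
  have hpartial : ∀ n, ∫⁻ ω, count s (ω n) ∂P + d * ∑ i ∈ Finset.range n, ∫⁻ ω, e i ω ∂P ≤
      ∫⁻ x, count s x ∂μ := by
    intro n
    induction n with
    | zero =>
      conv_rhs => rw [← map_eval_zero_pathMeasure α β μ]
      rw [lintegral_map (measurable_count s) (measurable_pi_apply 0)]
      simp [hP]
    | succ n ih =>
      refine le_trans ?_ ih
      rw [Finset.sum_range_succ, mul_add, add_comm (d * _), ← add_assoc]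
      gcongr
      rw [hP, lintegral_pathMeasure_succ α β μ (measurable_count s), ← hP,
        ← lintegral_const_mul _ (he n), ← lintegral_add_right _ ((he n).const_mul d)]
      exact lintegral_mono fun ω => hdrift (ω n)
  calc d * meanTau α β μ ≤ d * ∫⁻ ω, ∑' n, e n ω ∂P := by
        unfold meanTau
        gcongr with ω
        exact tau_le_tsum ω
    _ = d * ∑' n, ∫⁻ ω, e n ω ∂P := by
        rw [lintegral_tsum fun n => (he n).aemeasurable]
    _ ≤ _ := by
        rw [← ENNReal.tsum_mul_left]
        refine ENNReal.tsum_le_of_sum_range_le fun n => ?_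
        rw [← Finset.mul_sum]
        exact le_add_self.trans (hpartial n)

/-! ### Initial count and greatest length -/

theorem encard_le_span {S : Set ℤ} (hS : S.Finite) : S.encard ≤ span S := by
  unfold span
  split_ifs with hne
  · have hsub : S ⊆ (Finset.Icc (sInf S) (sSup S) : Finset ℤ) := fun i hi => by
      simpa using And.intro (csInf_le hS.bddBelow hi) (le_csSup hS.bddAbove hi)
    refine (Set.encard_le_encard hsub).trans ?_
    rw [Set.encard_coe_eq_coe_finsetCard, Int.card_Icc, add_sub_right_comm]
  · simp [Set.not_nonempty_iff_eq_empty.1 hne]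

theorem countable_close (y : Config) : {x | Close x y}.Countable := by
  have h : Set.Countable {S : Set ℤ | S.Finite} := Set.Countable.ofPred_finite
  refine Set.MapsTo.countable_of_injOn (f := fun x : Config => {i | x i ≠ y i})
    (t := {S : Set ℤ | S.Finite}) (fun x hx => hx) ?_ h
  intro x _ z _ hxz
  funext i
  have hi : (x i ≠ y i) ↔ (z i ≠ y i) := Set.ext_iff.1 hxz i
  revert hi
  cases x i <;> cases y i <;> cases z i <;> simp

/-- Needed because `giant` sees only atoms: on a countable set, the points of zero mass form a null
set. -/
theorem ae_measure_singleton_ne_zero {μ : Measure Config} {S : Set Config} (hS : S.Countable)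
    (hμ : ∀ᵐ x ∂μ, x ∈ S) : ∀ᵐ x ∂μ, x ∈ S ∧ μ {x} ≠ 0 := by
  have hnull : μ {x ∈ S | μ {x} = 0} = 0 := by
    rw [← Set.biUnion_of_singleton {x ∈ S | μ {x} = 0},
      measure_biUnion_null_iff (hS.mono (Set.sep_subset _ _))]
    exact fun x hx => hx.2
  filter_upwards [hμ, measure_eq_zero_iff_ae_notMem.1 hnull] with x hx hx'
  exact ⟨hx, fun h => hx' ⟨hx, h⟩⟩

theorem count_true_le_length {x : Config} (hx : x ∈ islandsPlus) :
    count true x ≤ ((length x : ℕ∞) : ℝ≥0∞) := by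
  have hfin : {i | x i = true}.Finite := by
    simpa [islandsPlus, Close, allMinus] using hx
  rw [count_eq_encard, length, if_pos hx]
  exact_mod_cast encard_le_span hfin

theorem count_false_le_length {x : Config} (hx : x ∈ islandsMinus) :
    count false x ≤ ((length x : ℕ∞) : ℝ≥0∞) := by
  have hfin : {i | x i = false}.Finite := by
    simpa [islandsMinus, Close, allPlus] using hx
  -- `length` tests for an island of pluses first; since `ℤ` is infinite, no configuration is an
  -- island of both kinds.
  have hnot : x ∉ islandsPlus := fun h => by
    have hfin' : {i | x i = true}.Finite := by
      simpa [islandsPlus, Close, allMinus] using h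
    refine Set.infinite_univ (α := ℤ) ((hfin.union hfin').subset fun i _ => ?_)
    cases h : x i <;> simp [h]
  rw [count_eq_encard, length, if_neg hnot]
  exact_mod_cast encard_le_span hfin

theorem lintegral_count_le_giant {μ : Measure Config} [IsProbabilityMeasure μ] {s : Spin}
    {S : Set Config} (hS : S.Countable) (hsub : S ⊆ islands) (hμ : ∀ᵐ x ∂μ, x ∈ S)
    (hlen : ∀ x ∈ S, count s x ≤ ((length x : ℕ∞) : ℝ≥0∞)) :
    ∫⁻ x, count s x ∂μ ≤ (giant μ : ℝ≥0∞) := by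
  calc ∫⁻ x, count s x ∂μ ≤ ∫⁻ _, (giant μ : ℝ≥0∞) ∂μ := by
        refine lintegral_mono_ae ?_
        filter_upwards [ae_measure_singleton_ne_zero hS hμ] with x hx
        refine (hlen x hx.1).trans ?_
        have h : (length x : ℕ∞) ≤ giant μ :=
          le_iSup₂_of_le (f := fun (x : Config) (_ : x ∈ {x | x ∈ islands ∧ μ {x} ≠ 0}) =>
            (length x : ℕ∞)) x ⟨hsub hx.1, hx.2⟩ le_rfl
        exact_mod_cast h
    _ = _ := by simp

/-! ### The two regimes -/

theorem meanTau_le_of_mul_le {α β : I} {μ : Measure Config} {d : ℝ≥0} (hd : d ≠ 0)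
    (h : (d : ℝ≥0∞) * meanTau α β μ ≤ (giant μ : ℝ≥0∞)) :
    meanTau α β μ ≤ (d⁻¹ : ℝ≥0) * (1 + (giant μ : ℝ≥0∞)) := by
  rw [ENNReal.coe_inv hd, mul_comm, ← div_eq_mul_inv,
    ENNReal.le_div_iff_mul_le (by simp [hd]) (by simp), mul_comm]
  exact h.trans le_add_self

theorem erodesPlusInMeanLinearTime {α β : I} (h : (α : ℝ) < 1 - (β : ℝ)) :
    ErodesPlusInMeanLinearTime α β := by
  have hd0 : 0 < 1 - (α : ℝ) - β := by linarith
  obtain ⟨d, hd⟩ : ∃ d : ℝ≥0, (d : ℝ) = 1 - (α : ℝ) - β := ⟨⟨_, hd0.le⟩, rfl⟩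
  refine ⟨d⁻¹, fun μ hμ _ => ?_⟩
  have := hμ.1
  -- The pair `-+` forces `c ≥ α`; with `c = α`, the pair `+-` leaves exactly `d = 1 - α - β`.
  refine meanTau_le_of_mul_le (fun h => hd0.ne' (by rw [← hd, h, NNReal.coe_zero]))
    ((mul_meanTau_le α β true d (lintegral_count_add_le α β true (unitInterval.toNNReal α) d
      (by simp) ?_) μ).trans
    (lintegral_count_le_giant (countable_close allMinus) Set.subset_union_right hμ.2
      fun x hx => count_true_le_length hx))
  have key : unitInterval.toNNReal β + unitInterval.toNNReal α + d = 1 := by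
    ext
    rw [NNReal.coe_add, NNReal.coe_add, hd]
    simp only [unitInterval.coe_toNNReal, NNReal.coe_one]
    ring
  have key' : (unitInterval.toNNReal β : ℝ≥0∞) + unitInterval.toNNReal α + d = 1 := by
    exact_mod_cast key
  intro a b
  cases a <;> cases b <;> simp [thetaPlus, key']

theorem erodesMinusInMeanLinearTime {α β : I} (h : (α : ℝ) > 1 - (β : ℝ)) :
    ErodesMinusInMeanLinearTime α β := by
  have hd0 : 0 < (α : ℝ) + β - 1 := by linarith
  obtain ⟨d, hd⟩ : ∃ d : ℝ≥0, (d : ℝ) = (α : ℝ) + β - 1 := ⟨⟨_, hd0.le⟩, rfl⟩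
  refine ⟨d⁻¹, fun μ hμ _ => ?_⟩
  have := hμ.1
  -- For minuses, the pair `+-` creates a minus with probability `1 - β`, hence `c = 1 - β`.
  refine meanTau_le_of_mul_le (fun h => hd0.ne' (by rw [← hd, h, NNReal.coe_zero]))
    ((mul_meanTau_le α β false d (lintegral_count_add_le α β false
      (unitInterval.toNNReal (unitInterval.symm β)) d (by simp) ?_) μ).trans
    (lintegral_count_le_giant (countable_close allPlus) Set.subset_union_left hμ.2
      fun x hx => count_false_le_length hx))
  have key : unitInterval.toNNReal (unitInterval.symm α) +
      unitInterval.toNNReal (unitInterval.symm β) + d = 1 := by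
    ext
    rw [NNReal.coe_add, NNReal.coe_add, hd]
    simp only [unitInterval.coe_toNNReal, unitInterval.coe_symm_eq, NNReal.coe_one]
    ring
  have key' : (unitInterval.toNNReal (unitInterval.symm α) : ℝ≥0∞) +
      unitInterval.toNNReal (unitInterval.symm β) + d = 1 := by
    exact_mod_cast key
  intro a b
  cases a <;> cases b <;> simp [thetaPlus, key']

end IslandPCA

theorem theorem4 (α β : unitInterval) (hα : 0 < (α : ℝ)) (hβ : (β : ℝ) < 1) :
    ((α : ℝ) < 1 - (β : ℝ) → IslandPCA.ErodesPlusInMeanLinearTime α β) ∧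
    ((α : ℝ) > 1 - (β : ℝ) → IslandPCA.ErodesMinusInMeanLinearTime α β) :=
  ⟨IslandPCA.erodesPlusInMeanLinearTime, IslandPCA.erodesMinusInMeanLinearTime⟩
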